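/- **Theorem (Mermin–Wagner).** Let $S^{(1)}=\frac12\begin{pmatrix}0&1\\1&0\end{pmatrix}$, $S^{(2)}=\frac12\begin{pmatrix}0&-\mathrm i\\ \mathrm i&0\end{pmatrix}$, $S^{(3)}=\frac12\begin{pmatrix}1&0\\0&-1\end{pmatrix}$ be the spin-$\frac12$ matrices. For a finite simple graph $\Lambda=(\mathcal V,\mathcal E)$, $x\in\mathcal V$ and $i\in\{1,2,3\}$, let $S_x^{(i)}=S^{(i)}\otimes\mathrm{Id}_{\mathcal V\setminus\{x\}}$, acting on $\bigotimes_{x\in\mathcal V}\mathbb C^2$. For $\beta\ge 0$ and $h\in\mathbb R$ let $$H_{\Lambda,h}=-\sum_{\{x,y\}\in\mathcal E}\ \sum_{i=1}^{3}S_x^{(i)}S_y^{(i)}-h\sum_{x\in\mathcal V}S_x^{(3)},\qquad \langle A\rangle_{\Lambda,\beta,h}=\frac{\operatorname{Tr}\,A\,\mathrm e^{-\beta H_{\Lambda,h}}}{\operatorname{Tr}\,\mathrm e^{-\beta H_{\Lambda,h}}},\qquad M_\Lambda=\sum_{x\in\mathcal V}S_x^{(3)}$$ be the Hamiltonian of the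 Heisenberg ferromagnet, its Gibbs state, and the magnetization operator. For $d,n\ge1$ let $\Lambda_n^{\mathrm{per}}$ be the cubic box of side $n$ in $\mathbb Z^d$ with periodic boundary conditions and nearest-neighbour edges, that is, the graph with vertex set $(\mathbb Z/n\mathbb Z)^d$ in which two distinct vertices form an edge if and only if they differ by $\pm$ a unit coordinate vector. If $d=1$ or $d=2$, then for every $\beta\in[0,\infty)$ the residual magnetization $$m^*_{\mathrm{res}}(\beta)=\lim_{h\to0+}\ \liminf_{n\to\infty}\ \frac1{n^d}\,\bigl\langle M_{\Lambda_n^{\mathrm{per}}}\bigr\rangle_{\Lambda_n^{\mathrm{per}},\beta,h}$$ exists and is equal to $0$. -/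

import Mathlib

open Filter Topology

noncomputable section

namespace Heisenberg

/-- The spin-1/2 matrices `S⁽¹⁾, S⁽²⁾, S⁽³⁾` (indexed by `0, 1, 2`) on `ℂ²`; the index `0 : Fin 2`
is the state `|1/2⟩` and `1 : Fin 2` is the state `|-1/2⟩`. -/
def spinMatrix : Fin 3 → Matrix (Fin 2) (Fin 2) ℂ :=
  ![(1 / 2 : ℂ) • !![0, 1; 1, 0],
    (1 / 2 : ℂ) • !![0, -Complex.I; Complex.I, 0],
    (1 / 2 : ℂ) • !![1, 0; 0, -1]]

/-- Operators on `⨂_{x ∈ V} ℂ²`, as matrices in the orthonormal product basis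
`|s⟩ = ⨂_x |s_x⟩`, which is indexed by the spin configurations `s : V → Fin 2`. -/
abbrev Operator (V : Type) : Type := Matrix (V → Fin 2) (V → Fin 2) ℂ

section Graph

variable {V : Type} [Fintype V] [DecidableEq V]

/-- The operator `A ⊗ Id_{V ∖ {x}}`. -/
def siteOp (x : V) (A : Matrix (Fin 2) (Fin 2) ℂ) : Operator V :=
  Matrix.of fun s t => if ∀ y, y ≠ x → s y = t y then A (s x) (t x) else 0

/-- The spin operator `S_x⁽ⁱ⁾`. -/
def spinOp (i : Fin 3) (x : V) : Operator V := siteOp x (spinMatrix i)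

/-- `S_x · S_y = ∑ᵢ S_x⁽ⁱ⁾ S_y⁽ⁱ⁾`. -/
def spinDot (x y : V) : Operator V := ∑ i : Fin 3, spinOp i x * spinOp i y

/-- The magnetization `M = ∑_x S_x⁽³⁾`. -/
def magnetization (V : Type) [Fintype V] [DecidableEq V] : Operator V :=
  ∑ x : V, spinOp 2 x

/-- The ferromagnetic Heisenberg Hamiltonian
`H = - ∑_{{x,y} ∈ E} S_x · S_y - h ∑_x S_x⁽³⁾`. Every edge `{x,y}` occurs in the double sum as the
two ordered pairs `(x,y)` and `(y,x)`, whence the factor `1/2`. -/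
def hamiltonian (G : SimpleGraph V) [DecidableRel G.Adj] (h : ℝ) : Operator V :=
  -((1 / 2 : ℂ) • ∑ x : V, ∑ y : V, if G.Adj x y then spinDot x y else 0)
    - (h : ℂ) • magnetization V

/-- The Boltzmann operator `exp(-β H)`. -/
def boltzmann (G : SimpleGraph V) [DecidableRel G.Adj] (β h : ℝ) : Operator V :=
  NormedSpace.exp ((-β : ℂ) • hamiltonian G h)

/-- The partition function `Z = Tr exp(-β H)`. -/
def partitionFunction (G : SimpleGraph V) [DecidableRel G.Adj] (β h : ℝ) : ℂ :=
  (boltzmann G β h).trace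

/-- The Gibbs state `⟨A⟩ = Tr (A exp(-β H)) / Z`. -/
def gibbs (G : SimpleGraph V) [DecidableRel G.Adj] (β h : ℝ) (A : Operator V) : ℂ :=
  (A * boltzmann G β h).trace / partitionFunction G β h

end Graph

/-- The cubic box of side `n` in `ℤᵈ` with periodic boundary conditions and nearest-neighbour
edges, i.e. the discrete torus `(ℤ/nℤ)ᵈ` (used for `n ≥ 1`). -/
def periodicBox (d n : ℕ) : SimpleGraph (Fin d → ZMod n) where
  Adj x y := x ≠ y ∧ ∃ i, y = x + Pi.single i 1 ∨ x = y + Pi.single i 1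
  symm := ⟨fun _ _ h => ⟨h.1.symm, h.2.imp fun _ hi => hi.symm⟩⟩
  loopless := ⟨fun _ h => h.1 rfl⟩

instance periodicBox.decidableAdj (d n : ℕ) : DecidableRel (periodicBox d n).Adj :=
  fun x y => inferInstanceAs
    (Decidable (x ≠ y ∧ ∃ i, y = x + Pi.single i 1 ∨ x = y + Pi.single i 1))

/-- The magnetization per site `n⁻ᵈ ⟨M⟩` in the periodic box of side `n`. (The expectation of the
self-adjoint operator `M` is a real number.) -/
def magnetizationDensity (d n : ℕ) [NeZero n] (β h : ℝ) : ℝ :=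
  (gibbs (periodicBox d n) β h (magnetization (Fin d → ZMod n))).re / (n : ℝ) ^ d

/-- `liminf_{n → ∞} n⁻ᵈ ⟨M⟩` along the periodic boxes of sides `1, 2, 3, …`. -/
def limitMagnetization (d : ℕ) (β h : ℝ) : ℝ :=
  liminf (fun n : ℕ => magnetizationDensity d (n + 1) β h) atTop

/-- The residual magnetization `lim_{h → 0+} liminf_{n → ∞} n⁻ᵈ ⟨M⟩` exists and is equal to `m`. -/
def HasResidualMagnetization (d : ℕ) (β m : ℝ) : Prop :=
  Tendsto (fun h : ℝ => limitMagnetization d β h) (𝓝[>] 0) (𝓝 m)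

end Heisenberg

end

namespace Heisenberg
section
open scoped ComplexOrder
variable {V : Type} [Fintype V] [DecidableEq V]

theorem conjTranspose_siteOp (x : V) (A : Matrix (Fin 2) (Fin 2) ℂ) :
    (siteOp x A).conjTranspose = siteOp x A.conjTranspose := by
  ext s t
  simp only [siteOp, Matrix.conjTranspose_apply, Matrix.of_apply]
  by_cases h : ∀ y, y ≠ x → s y = t y
  · rw [if_pos h, if_pos fun y hy => (h y hy).symm]
  · rw [if_neg h, if_neg fun h' => h fun y hy => (h' y hy).symm, star_zero]

theorem conjTranspose_spinOp (i : Fin 3) (x : V) :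
    (spinOp i x).conjTranspose = spinOp i x := by
  rw [spinOp, conjTranspose_siteOp]
  congr 1
  ext a b
  fin_cases i <;> fin_cases a <;> fin_cases b <;> simp [spinMatrix]

theorem conjTranspose_spinDot (x y : V) :
    (spinDot x y).conjTranspose = spinDot y x := by
  simp [spinDot, Matrix.conjTranspose_sum, Matrix.conjTranspose_mul, conjTranspose_spinOp]

theorem isHermitian_magnetization : (magnetization V).IsHermitian := by
  simp [Matrix.IsHermitian, magnetization, Matrix.conjTranspose_sum, conjTranspose_spinOp]

theorem isHermitian_hamiltonian (G : SimpleGraph V) [DecidableRel G.Adj] (h : ℝ) :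
    (hamiltonian G h).IsHermitian := by
  have h1 : (∑ x : V, ∑ y : V, if G.Adj x y then spinDot x y else 0).conjTranspose
      = ∑ x : V, ∑ y : V, if G.Adj x y then spinDot x y else 0 := by
    simp only [Matrix.conjTranspose_sum]
    rw [Finset.sum_comm]
    refine Finset.sum_congr rfl fun x _ => Finset.sum_congr rfl fun y _ => ?_
    by_cases hxy : G.Adj x y
    · rw [if_pos hxy, if_pos hxy.symm, conjTranspose_spinDot]
    · rw [if_neg hxy, if_neg fun h' => hxy h'.symm, Matrix.conjTranspose_zero]
  simp only [Matrix.IsHermitian, hamiltonian, Matrix.conjTranspose_sub, Matrix.conjTranspose_neg,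
    Matrix.conjTranspose_smul, h1, isHermitian_magnetization.eq]
  simp

theorem posSemidef_boltzmann (G : SimpleGraph V) [DecidableRel G.Adj] (β h : ℝ) :
    (boltzmann G β h).PosSemidef := by
  have hB : (boltzmann G (β / 2) h).IsHermitian := by
    refine Matrix.IsHermitian.exp ?_
    simp only [Matrix.IsHermitian, Matrix.conjTranspose_smul, (isHermitian_hamiltonian G h).eq]
    simp
  have hmul : boltzmann G β h =
      (boltzmann G (β / 2) h).conjTranspose * boltzmann G (β / 2) h := by
    rw [hB.eq, boltzmann, boltzmann, ← Matrix.exp_add_of_commute _ _ (Commute.refl _), ← add_smul]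
    congr 2
    push_cast
    ring
  rw [hmul]
  exact Matrix.posSemidef_conjTranspose_mul_self _

theorem magnetization_eq_diagonal : magnetization V =
    Matrix.diagonal fun s => ((∑ x : V, if s x = 0 then (1 / 2 : ℝ) else -(1 / 2) : ℝ) : ℂ) := by
  have key (x : V) : spinOp 2 x =
      Matrix.diagonal fun s : V → Fin 2 => ((if s x = 0 then (1 / 2 : ℝ) else -(1 / 2) : ℝ) : ℂ) := by
    ext s t
    simp only [spinOp, siteOp, Matrix.of_apply, Matrix.diagonal_apply]
    by_cases hst : s = t
    · subst hst
      simp only [implies_true, if_true]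
      rcases Fin.exists_fin_two.1 ⟨s x, rfl⟩ with h0 | h0 <;> rw [h0] <;> simp [spinMatrix]
    · rw [if_neg hst]
      split_ifs with h
      · have hx : s x ≠ t x := fun hx => hst <| funext fun y => by
          by_cases hy : y = x
          · rw [hy, hx]
          · exact h y hy
        generalize s x = a at hx
        generalize t x = b at hx
        fin_cases a <;> fin_cases b <;> simp_all [spinMatrix]
      · rfl
  ext s t
  simp only [magnetization, key, Matrix.sum_apply, Matrix.diagonal_apply]
  split_ifs
  · push_cast; rfl
  · simp

theorem gibbs_magnetization (G : SimpleGraph V) [DecidableRel G.Adj] (β h : ℝ) :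
    gibbs G β h (magnetization V) =
      (((∑ s : V → Fin 2, (∑ x : V, if s x = 0 then (1 / 2 : ℝ) else -(1 / 2)) *
        (boltzmann G β h s s).re) / ∑ s : V → Fin 2, (boltzmann G β h s s).re : ℝ) : ℂ) := by
  have h1 (s : V → Fin 2) : boltzmann G β h s s = ((boltzmann G β h s s).re : ℂ) :=
    (Complex.conj_eq_iff_re.1 ((posSemidef_boltzmann G β h).isHermitian.apply s s)).symm
  rw [gibbs, partitionFunction, magnetization_eq_diagonal, Complex.ofReal_div,
    Complex.ofReal_sum, Complex.ofReal_sum]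
  simp only [Matrix.trace, Matrix.diag_apply, Matrix.diagonal_mul]
  congr 1
  · refine Finset.sum_congr rfl fun s _ => ?_
    rw [Complex.ofReal_mul, ← h1]
  · exact Finset.sum_congr rfl fun s _ => h1 s

/-- The expectation of the magnetization is a real number. -/
theorem gibbs_magnetization_im (G : SimpleGraph V) [DecidableRel G.Adj] (β h : ℝ) :
    (gibbs G β h (magnetization V)).im = 0 := by
  rw [gibbs_magnetization, Complex.ofReal_im]

theorem abs_gibbs_magnetization_le (G : SimpleGraph V) [DecidableRel G.Adj] (β h : ℝ) :
    |(gibbs G β h (magnetization V)).re| ≤ Fintype.card V / 2 := by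
  have h0 (s : V → Fin 2) : 0 ≤ (boltzmann G β h s s).re :=
    (Complex.le_def.1 ((posSemidef_boltzmann G β h).diag_nonneg (i := s))).1
  rw [gibbs_magnetization, Complex.ofReal_re, abs_div,
    abs_of_nonneg (Finset.sum_nonneg fun s _ => h0 s)]
  refine div_le_of_le_mul₀ (Finset.sum_nonneg fun s _ => h0 s) (by positivity) ?_
  rw [Finset.mul_sum]
  refine (Finset.abs_sum_le_sum_abs _ _).trans (Finset.sum_le_sum fun s _ => ?_)
  rw [abs_mul, abs_of_nonneg (h0 s)]
  refine mul_le_mul_of_nonneg_right ((Finset.abs_sum_le_sum_abs _ _).trans ?_) (h0 s)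
  refine (Finset.sum_le_card_nsmul _ _ (1 / 2 : ℝ) fun x _ => ?_).trans ?_
  · split_ifs <;> norm_num [abs_of_pos]
  · rw [Finset.card_univ, nsmul_eq_mul]
    linarith

end

/-- The magnetization per site lies in `[-1/2, 1/2]`; in particular its `liminf` is that of a
bounded sequence. -/
theorem abs_magnetizationDensity_le (d n : ℕ) [NeZero n] (β h : ℝ) :
    |magnetizationDensity d n β h| ≤ 1 / 2 := by
  have hn : (0 : ℝ) < (n : ℝ) ^ d := by
    have := NeZero.pos n
    positivity
  have := abs_gibbs_magnetization_le (periodicBox d n) β h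
  rw [magnetizationDensity, abs_div, abs_of_pos hn, div_le_iff₀ hn]
  refine this.trans (le_of_eq ?_)
  simp [ZMod.card]
  ring
end Heisenberg

/-!
The proof works in position space. For a profile `φ : V → ℝ` with `φ o = 1`, Bogoliubov's
inequality (`bogoliubov`) with `C = ∑ₓ φₓ Sₓ⁽¹⁾` and `A = S_o⁽²⁾` bounds `⟨S_o⁽³⁾⟩²`, since
`[C, A] = i S_o⁽³⁾`, by `β / 2` times the expectation of `-[C, [C, H]]`. The interaction `S_x · S_y`
is invariant under simultaneous rotations of both spins, so its double commutator with `C` is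
proportional to `(φ_x - φ_y)²`, while that of the magnetization is `∑ₓ φₓ² Sₓ⁽³⁾`. Hence
(`sq_weight_spinOp_le`)
`⟨S_o⁽³⁾⟩² ≤ β / 2 * (1 / 4 * ∑_{x ∼ y} (φ_x - φ_y)² + |h| / 2 * ∑ₓ φₓ²)`,
where the first sum is over ordered pairs of neighbours.

On the torus of dimension one or two the spheres of radius `r` have `O(r + 1)` points
(`card_torusNorm_eq_le`). A profile around `o` which decreases from `1` to `0` over the distance
`R`, with increments proportional to `1 / (r + 1)`, therefore has gradient energy
`O(1 / ∑_{j < R} 1 / (j + 1))`, uniformly in the size `n` (`energy_logProfile_le`), and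
`∑ₓ φₓ² = O(R²)`. As the bound is the same for all sites `o`, it holds for the density of
magnetization and for its `liminf` in `n` (`sq_limitMagnetization_le`). Letting `h → 0+` and then
`R → ∞` gives the theorem, because the harmonic series diverges. No information on the Gibbs
state beyond its positivity is needed, in particular no translation invariance.
-/

noncomputable section

namespace Heisenberg

-- makes the Lie bracket API of Mathlib available for the commutator of matrices
attribute [local instance] LieRing.ofAssociativeRing

/-! ### The Bogoliubov inequality -/

section Bogoliubov

open Matrix

variable {ι : Type*} [Fintype ι] [DecidableEq ι]

/-- The comparison of the difference of two Boltzmann factors with their mean that replaces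
`tanh t ≤ t` in Bogoliubov's inequality, at the cost of a factor two. -/
theorem sq_exp_sub_exp_le (a b : ℝ) :
    (Real.exp a - Real.exp b) ^ 2
      ≤ (Real.exp a + Real.exp b) * ((Real.exp a - Real.exp b) * (a - b)) := by
  wlog hab : b ≤ a generalizing a b
  · have := this b a (le_of_not_ge hab)
    linarith
  have h1 : 0 ≤ Real.exp a - Real.exp b := sub_nonneg.2 (Real.exp_le_exp.2 hab)
  -- `1 - exp (b - a) ≤ a - b`, multiplied by `exp a`
  have h2 : Real.exp a - Real.exp b ≤ Real.exp a * (a - b) := by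
    have h3 := Real.add_one_le_exp (b - a)
    have h4 : Real.exp b = Real.exp a * Real.exp (b - a) := by
      rw [← Real.exp_add]
      congr 1
      ring
    rw [h4]
    nlinarith [Real.exp_pos a]
  have h5 : 0 ≤ Real.exp b * (a - b) := mul_nonneg (Real.exp_pos b).le (sub_nonneg.2 hab)
  nlinarith

theorem trace_lie_mul_diagonal (A C : Matrix ι ι ℂ) (w : ι → ℂ) :
    (⁅C, A⁆ * diagonal w).trace = ∑ j, ∑ k, C j k * A k j * (w j - w k) := by
  have h1 (X Y : Matrix ι ι ℂ) :
      (X * Y * diagonal w).trace = ∑ j, ∑ k, X j k * Y k j * w j := by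
    simp only [trace, diag_apply, mul_diagonal]
    simp only [mul_apply, Finset.sum_mul]
  rw [Ring.lie_def, sub_mul, trace_sub, h1, h1]
  simp only [mul_sub, Finset.sum_sub_distrib]
  congr 1
  rw [Finset.sum_comm]
  exact Finset.sum_congr rfl fun j _ => Finset.sum_congr rfl fun k _ => by ring

theorem IsHermitian.apply_mul_apply {κ : Type*} {A : Matrix κ κ ℂ} (hA : A.IsHermitian) (j k : κ) :
    A j k * A k j = ((‖A j k‖ ^ 2 : ℝ) : ℂ) := by
  rw [← hA.apply k j, Complex.star_def, Complex.mul_conj, Complex.normSq_eq_norm_sq]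

theorem trace_sq_mul_diagonal {A : Matrix ι ι ℂ} (hA : A.IsHermitian) (w : ι → ℝ) :
    2 * (A * A * diagonal fun j => (w j : ℂ)).trace.re = ∑ j, ∑ k, ‖A j k‖ ^ 2 * (w j + w k) := by
  have h1 : (A * A * diagonal fun j => (w j : ℂ)).trace.re = ∑ j, ∑ k, ‖A j k‖ ^ 2 * w j := by
    simp only [trace, diag_apply, mul_diagonal]
    simp only [mul_apply, Finset.sum_mul,
      IsHermitian.apply_mul_apply hA, ← Complex.ofReal_mul, Complex.re_sum, Complex.ofReal_re]
  have h2 : ∑ j, ∑ k, ‖A j k‖ ^ 2 * w j = ∑ j, ∑ k, ‖A j k‖ ^ 2 * w k := by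
    rw [Finset.sum_comm]
    refine Finset.sum_congr rfl fun j _ => Finset.sum_congr rfl fun k _ => ?_
    rw [← hA.apply k j, norm_star]
  simp only [mul_add, Finset.sum_add_distrib]
  rw [h1, ← h2, two_mul]

theorem trace_lie_lie_mul_diagonal {C : Matrix ι ι ℂ} (hC : C.IsHermitian) (E w : ι → ℝ) :
    -(⁅C, ⁅C, diagonal fun j => (E j : ℂ)⁆⁆ * diagonal fun j => (w j : ℂ)).trace.re
      = ∑ j, ∑ k, ‖C j k‖ ^ 2 * ((w j - w k) * (E k - E j)) := by
  rw [trace_lie_mul_diagonal, Complex.re_sum, ← Finset.sum_neg_distrib]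
  refine Finset.sum_congr rfl fun j _ => ?_
  rw [Complex.re_sum, ← Finset.sum_neg_distrib]
  refine Finset.sum_congr rfl fun k _ => ?_
  have h1 : C j k * ⁅C, diagonal fun j => (E j : ℂ)⁆ k j * ((w j : ℂ) - w k)
      = ((‖C j k‖ ^ 2 * ((w j - w k) * (E j - E k)) : ℝ) : ℂ) := by
    rw [Ring.lie_def, Matrix.sub_apply, mul_diagonal, diagonal_mul, Complex.ofReal_mul,
      ← IsHermitian.apply_mul_apply hC j k]
    push_cast
    ring
  rw [h1, Complex.ofReal_re]
  ring

/-- The Bogoliubov inequality for a diagonal Hamiltonian. -/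
theorem bogoliubov_diagonal {A C : Matrix ι ι ℂ} (hA : A.IsHermitian) (hC : C.IsHermitian)
    (E : ι → ℝ) {β : ℝ} (hβ : 0 ≤ β) :
    ‖(⁅C, A⁆ * diagonal fun j => (Real.exp (-β * E j) : ℂ)).trace‖ ^ 2
      ≤ β * (2 * (A * A * diagonal fun j => (Real.exp (-β * E j) : ℂ)).trace.re) *
        -(⁅C, ⁅C, diagonal fun j => (E j : ℂ)⁆⁆ *
          diagonal fun j => (Real.exp (-β * E j) : ℂ)).trace.re := by
  set w : ι → ℝ := fun j => Real.exp (-β * E j) with hw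
  have hexp (j k : ι) : (w j - w k) ^ 2 ≤ β * (w j + w k) * ((w j - w k) * (E k - E j)) := by
    refine (sq_exp_sub_exp_le (-β * E j) (-β * E k)).trans_eq ?_
    simp only [hw]
    ring
  have hsign (j k : ι) : 0 ≤ (w j - w k) * (E k - E j) := by
    rcases le_total (E j) (E k) with h | h
    · refine mul_nonneg (sub_nonneg.2 (Real.exp_le_exp.2 ?_)) (sub_nonneg.2 h)
      nlinarith
    · refine mul_nonneg_of_nonpos_of_nonpos (sub_nonpos.2 (Real.exp_le_exp.2 ?_)) (sub_nonpos.2 h)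
      nlinarith
  have hpos (j k : ι) : 0 ≤ w j + w k := (add_pos (Real.exp_pos _) (Real.exp_pos _)).le
  rw [trace_lie_mul_diagonal, trace_sq_mul_diagonal hA, trace_lie_lie_mul_diagonal hC]
  simp only [← Fintype.sum_prod_type']
  rw [Finset.mul_sum _ _ β]
  have hnorm : ‖∑ p : ι × ι, C p.1 p.2 * A p.2 p.1 * ((w p.1 : ℂ) - w p.2)‖
      ≤ ∑ p : ι × ι, ‖C p.1 p.2‖ * ‖A p.1 p.2‖ * |w p.1 - w p.2| := by
    refine (norm_sum_le _ _).trans_eq (Finset.sum_congr rfl fun p _ => ?_)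
    rw [norm_mul, norm_mul, ← hA.apply p.2 p.1, norm_star, ← Complex.ofReal_sub,
      Complex.norm_real, Real.norm_eq_abs]
  refine (pow_le_pow_left₀ (norm_nonneg _) hnorm 2).trans ?_
  -- Cauchy-Schwarz, with `hexp` splitting the square of the Boltzmann difference `w j - w k`
  refine Finset.sum_sq_le_sum_mul_sum_of_sq_le_mul (R := ℝ) _ (fun p _ => ?_) (fun p _ => ?_)
    fun p _ => ?_
  · exact mul_nonneg hβ (mul_nonneg (sq_nonneg _) (hpos _ _))
  · have := hsign p.1 p.2
    exact mul_nonneg (sq_nonneg _) (by linarith)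
  · have := mul_le_mul_of_nonneg_left (hexp p.1 p.2)
      (sq_nonneg (‖C p.1 p.2‖ * ‖A p.1 p.2‖))
    rw [mul_pow, sq_abs]
    linarith

/-- **Bogoliubov inequality**, for the unnormalized Gibbs state of a Hermitian matrix `H` and
Hermitian `A`, `C`. The constant is twice the optimal one. -/
theorem bogoliubov {H A C : Matrix ι ι ℂ} (hH : H.IsHermitian) (hA : A.IsHermitian)
    (hC : C.IsHermitian) {β : ℝ} (hβ : 0 ≤ β) :
    ‖(⁅C, A⁆ * NormedSpace.exp ((-β : ℂ) • H)).trace‖ ^ 2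
      ≤ β * (2 * (A * A * NormedSpace.exp ((-β : ℂ) • H)).trace.re) *
        -(⁅C, ⁅C, H⁆⁆ * NormedSpace.exp ((-β : ℂ) • H)).trace.re := by
  set U := hH.eigenvectorUnitary
  set Φ := Unitary.conjStarAlgAut ℂ _ U
  set E := hH.eigenvalues
  have hΦH : Φ (diagonal fun j => (E j : ℂ)) = H := hH.spectral_theorem.symm
  have htr (X : Matrix ι ι ℂ) : (Φ X).trace = X.trace := by
    rw [Unitary.conjStarAlgAut_apply, trace_mul_cycle, Unitary.coe_star_mul_self, one_mul]
  have hexp : NormedSpace.exp ((-β : ℂ) • H)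
      = Φ (diagonal fun j => (Real.exp (-β * E j) : ℂ)) := by
    have h1 := Matrix.exp_units_conj (Unitary.toUnits U)
      ((-β : ℂ) • diagonal fun j => (E j : ℂ))
    have h2 : (-β : ℂ) • H = Φ ((-β : ℂ) • diagonal fun j => (E j : ℂ)) := by
      rw [map_smul, hΦH]
    rw [h2]
    refine h1.trans ?_
    rw [← diagonal_smul, exp_diagonal]
    refine congrArg Φ (congrArg diagonal (funext fun j => ?_))
    rw [Pi.coe_exp]
    simp [← Complex.exp_eq_exp_ℂ]
  have hlie (X Y : Matrix ι ι ℂ) : ⁅Φ X, Φ Y⁆ = Φ ⁅X, Y⁆ := by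
    simp only [Ring.lie_def, map_sub, map_mul]
  have hherm {X : Matrix ι ι ℂ} (hX : X.IsHermitian) : (Φ.symm X).IsHermitian := by
    have := map_star Φ.symm X
    rw [star_eq_conjTranspose, star_eq_conjTranspose, hX.eq] at this
    exact this.symm
  have key := bogoliubov_diagonal (hherm hA) (hherm hC) E hβ
  obtain ⟨A', rfl⟩ : ∃ A', Φ A' = A := ⟨_, Φ.apply_symm_apply A⟩
  obtain ⟨C', rfl⟩ : ∃ C', Φ C' = C := ⟨_, Φ.apply_symm_apply C⟩
  rw [StarAlgEquiv.symm_apply_apply, StarAlgEquiv.symm_apply_apply] at key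
  rw [hexp]
  have hlieH : ⁅Φ C', H⁆ = Φ ⁅C', diagonal fun j => (E j : ℂ)⁆ := by rw [← hlie, hΦH]
  simpa only [hlieH, hlie, ← map_mul, htr] using key

end Bogoliubov

/-! ### Algebra of the spin operators -/

section SpinAlgebra

variable {V : Type} [Fintype V] [DecidableEq V]

theorem siteOp_smul (x : V) (c : ℂ) (A : Matrix (Fin 2) (Fin 2) ℂ) :
    siteOp x (c • A) = c • siteOp x A := by
  ext s t
  simp [siteOp]

theorem siteOp_sub (x : V) (A B : Matrix (Fin 2) (Fin 2) ℂ) :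
    siteOp x (A - B) = siteOp x A - siteOp x B := by
  ext s t
  simp only [siteOp, Matrix.of_apply, Matrix.sub_apply]
  split_ifs <;> simp

theorem siteOp_one (x : V) : siteOp x 1 = (1 : Operator V) := by
  ext s t
  rw [siteOp, Matrix.of_apply, Matrix.one_apply, Matrix.one_apply, ← ite_and]
  refine if_congr ⟨fun h => funext fun y => ?_, fun h => ?_⟩ rfl rfl
  · by_cases hy : y = x
    · rw [hy, h.2]
    · exact h.1 y hy
  · simp [h]

theorem siteOp_mul_apply (x : V) (A : Matrix (Fin 2) (Fin 2) ℂ) (N : Operator V)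
    (s t : V → Fin 2) :
    (siteOp x A * N) s t = ∑ a, A (s x) a * N (Function.update s x a) t := by
  rw [Matrix.mul_apply]
  have h1 : ∑ a, A (s x) a * N (Function.update s x a) t
      = ∑ u ∈ Finset.univ.image (Function.update s x), A (s x) (u x) * N u t := by
    rw [Finset.sum_image (Function.update_injective s x).injOn]
    simp
  rw [h1]
  symm
  refine Finset.sum_subset_zero_on_sdiff (Finset.subset_univ _) (fun u hu => ?_) fun u hu => ?_
  · rw [siteOp, Matrix.of_apply, if_neg, zero_mul]
    refine fun h => (Finset.mem_sdiff.1 hu).2 (Finset.mem_image.2 ⟨u x, Finset.mem_univ _, ?_⟩)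
    exact Function.update_eq_iff.2 ⟨rfl, h⟩
  · obtain ⟨a, -, rfl⟩ := Finset.mem_image.1 hu
    rw [siteOp, Matrix.of_apply, if_pos]
    intro y hy
    rw [Function.update_of_ne hy]

theorem siteOp_mul_siteOp (x : V) (A B : Matrix (Fin 2) (Fin 2) ℂ) :
    siteOp x A * siteOp x B = siteOp x (A * B) := by
  ext s t
  have h1 (a : Fin 2) : (∀ y, y ≠ x → Function.update s x a y = t y) ↔ ∀ y, y ≠ x → s y = t y :=
    forall₂_congr fun y hy => by rw [Function.update_of_ne hy]
  rw [siteOp_mul_apply]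
  simp only [siteOp, Matrix.of_apply, Function.update_self, h1, Matrix.mul_apply]
  split_ifs <;> simp

theorem siteOp_mul_siteOp_of_ne {x y : V} (hxy : x ≠ y) (A B : Matrix (Fin 2) (Fin 2) ℂ)
    (s t : V → Fin 2) :
    (siteOp x A * siteOp y B) s t
      = if ∀ z, z ≠ x → z ≠ y → s z = t z then A (s x) (t x) * B (s y) (t y) else 0 := by
  have h1 (a : Fin 2) : (∀ z, z ≠ y → Function.update s x a z = t z) ↔
      a = t x ∧ ∀ z, z ≠ x → z ≠ y → s z = t z := by
    refine ⟨fun h => ⟨by simpa using h x hxy, fun z hzx hzy => ?_⟩, fun h z hz => ?_⟩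
    · simpa [hzx] using h z hzy
    · by_cases hzx : z = x
      · rw [hzx, Function.update_self, h.1]
      · rw [Function.update_of_ne hzx, h.2 z hzx hz]
  rw [siteOp_mul_apply]
  simp only [siteOp, Matrix.of_apply, h1, Function.update_of_ne hxy.symm]
  split_ifs with h
  · simp only [eq_true h, and_true, mul_ite, mul_zero, Finset.sum_ite_eq',
      Finset.mem_univ, if_true]
  · simp only [eq_false h, and_false, if_false, mul_zero, Finset.sum_const_zero]

theorem commute_siteOp {x y : V} (hxy : x ≠ y) (A B : Matrix (Fin 2) (Fin 2) ℂ) :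
    Commute (siteOp x A) (siteOp y B) := by
  ext s t
  rw [siteOp_mul_siteOp_of_ne hxy, siteOp_mul_siteOp_of_ne hxy.symm, mul_comm]
  congr 1
  exact propext (forall_congr' fun z => ⟨fun h hy hx => h hx hy, fun h hx hy => h hy hx⟩)

theorem spinOp_mul_self (i : Fin 3) (x : V) :
    spinOp i x * spinOp i x = (1 / 4 : ℂ) • (1 : Operator V) := by
  have h1 : spinMatrix i * spinMatrix i = (1 / 4 : ℂ) • 1 := by
    ext a b
    fin_cases i <;> fin_cases a <;> fin_cases b <;>
      simp [spinMatrix] <;> ring_nf <;> simp <;> norm_num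
  rw [spinOp, siteOp_mul_siteOp, h1, siteOp_smul, siteOp_one]

theorem lie_spinOp (i j : Fin 3) (x y : V) :
    ⁅spinOp i x, spinOp j y⁆ = if x = y then siteOp x ⁅spinMatrix i, spinMatrix j⁆ else 0 := by
  split_ifs with hxy
  · rw [← hxy, Ring.lie_def, Ring.lie_def, spinOp, spinOp, siteOp_mul_siteOp, siteOp_mul_siteOp,
      siteOp_sub]
  · exact (commute_siteOp hxy _ _).lie_eq

theorem lie_spinMatrix_one : ⁅spinMatrix 0, spinMatrix 1⁆ = Complex.I • spinMatrix 2 := by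
  ext a b
  rw [Ring.lie_def]
  fin_cases a <;> fin_cases b <;>
    simp [spinMatrix] <;> ring

theorem lie_spinMatrix_two : ⁅spinMatrix 0, spinMatrix 2⁆ = -Complex.I • spinMatrix 1 := by
  ext a b
  rw [Ring.lie_def]
  fin_cases a <;> fin_cases b <;>
    simp [spinMatrix] <;> ring_nf <;> simp <;> norm_num

theorem commute_spinOp {x y : V} (hxy : x ≠ y) (i j : Fin 3) :
    Commute (spinOp i x) (spinOp j y) :=
  commute_siteOp hxy _ _

/-- The operator `∑ₓ φₓ Sₓ⁽¹⁾`, the generator of the rotation about the first spin axis by an angle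
proportional to `φₓ` at the site `x`. -/
def twist (φ : V → ℝ) : Operator V := ∑ x, (φ x : ℂ) • spinOp 0 x

theorem isHermitian_twist (φ : V → ℝ) : (twist φ).IsHermitian := by
  simp [Matrix.IsHermitian, twist, Matrix.conjTranspose_sum, conjTranspose_spinOp]

theorem lie_twist_spinOp (φ : V → ℝ) (i : Fin 3) (x : V) :
    ⁅twist φ, spinOp i x⁆ = (φ x : ℂ) • siteOp x ⁅spinMatrix 0, spinMatrix i⁆ := by
  simp only [twist, sum_lie, smul_lie, lie_spinOp]
  rw [Finset.sum_eq_single x (fun y _ hy => by rw [if_neg hy, smul_zero]) (by simp), if_pos rfl]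

theorem lie_twist_spinOp_zero (φ : V → ℝ) (x : V) : ⁅twist φ, spinOp 0 x⁆ = 0 := by
  rw [lie_twist_spinOp, lie_self]
  ext s t
  simp [siteOp]

theorem lie_twist_spinOp_one (φ : V → ℝ) (x : V) :
    ⁅twist φ, spinOp 1 x⁆ = (φ x * Complex.I) • spinOp 2 x := by
  rw [lie_twist_spinOp, lie_spinMatrix_one, siteOp_smul, smul_smul, spinOp]

theorem lie_twist_spinOp_two (φ : V → ℝ) (x : V) :
    ⁅twist φ, spinOp 2 x⁆ = -(φ x * Complex.I) • spinOp 1 x := by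
  rw [lie_twist_spinOp, lie_spinMatrix_two, siteOp_smul, smul_smul, spinOp, mul_neg]

theorem lie_mul_eq {R : Type*} [Ring R] (a b c : R) : ⁅a, b * c⁆ = ⁅a, b⁆ * c + b * ⁅a, c⁆ := by
  simp only [Ring.lie_def]
  noncomm_ring

/-- Since `S_x · S_y` is invariant under simultaneous rotations of both spins, only the gradient of
`φ` enters. -/
theorem lie_twist_spinDot (φ : V → ℝ) (x y : V) :
    ⁅twist φ, spinDot x y⁆ = ((φ x - φ y : ℂ) * Complex.I) •
      (spinOp 2 x * spinOp 1 y - spinOp 1 x * spinOp 2 y) := by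
  simp only [spinDot, Fin.sum_univ_three, lie_add, lie_mul_eq, lie_twist_spinOp_zero,
    lie_twist_spinOp_one, lie_twist_spinOp_two, smul_mul_assoc, mul_smul_comm, zero_mul, mul_zero]
  module

theorem lie_twist_lie_twist_spinDot (φ : V → ℝ) (x y : V) :
    ⁅twist φ, ⁅twist φ, spinDot x y⁆⁆ = ((φ x - φ y : ℂ) ^ 2) •
      (spinOp 1 x * spinOp 1 y + spinOp 2 x * spinOp 2 y) := by
  have h1 : ⁅twist φ, spinOp 2 x * spinOp 1 y - spinOp 1 x * spinOp 2 y⁆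
      = (-(φ x - φ y : ℂ) * Complex.I) •
        (spinOp 1 x * spinOp 1 y + spinOp 2 x * spinOp 2 y) := by
    simp only [lie_sub, lie_mul_eq, lie_twist_spinOp_one, lie_twist_spinOp_two, smul_mul_assoc,
      mul_smul_comm]
    module
  rw [lie_twist_spinDot, lie_smul, h1, smul_smul]
  congr 1
  linear_combination (-(φ x - φ y : ℂ) ^ 2) * Complex.I_sq

theorem lie_twist_lie_twist_magnetization (φ : V → ℝ) :
    ⁅twist φ, ⁅twist φ, magnetization V⁆⁆ = ∑ x, ((φ x : ℂ) ^ 2) • spinOp 2 x := by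
  simp only [magnetization, lie_sum, lie_twist_spinOp_one, lie_twist_spinOp_two, lie_smul,
    smul_smul]
  refine Finset.sum_congr rfl fun x _ => ?_
  congr 1
  linear_combination (-(φ x : ℂ) ^ 2) * Complex.I_sq

theorem neg_lie_twist_lie_twist_hamiltonian (G : SimpleGraph V) [DecidableRel G.Adj] (h : ℝ)
    (φ : V → ℝ) :
    -⁅twist φ, ⁅twist φ, hamiltonian G h⁆⁆
      = (1 / 2 : ℂ) • ∑ x, ∑ y, (if G.Adj x y then ((φ x - φ y : ℂ) ^ 2) •
          (spinOp 1 x * spinOp 1 y + spinOp 2 x * spinOp 2 y) else 0)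
        + (h : ℂ) • ∑ x, ((φ x : ℂ) ^ 2) • spinOp 2 x := by
  have h1 (x y : V) : ⁅twist φ, ⁅twist φ, if G.Adj x y then spinDot x y else 0⁆⁆
      = if G.Adj x y then ((φ x - φ y : ℂ) ^ 2) •
          (spinOp 1 x * spinOp 1 y + spinOp 2 x * spinOp 2 y) else 0 := by
    split_ifs
    · exact lie_twist_lie_twist_spinDot φ x y
    · rw [lie_zero, lie_zero]
  simp only [hamiltonian, lie_sub, lie_neg, lie_smul, lie_sum, h1,
    lie_twist_lie_twist_magnetization]
  abel

end SpinAlgebra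

/-! ### Bounds in the Gibbs state -/

section Gibbs

open scoped ComplexOrder

variable {V : Type} [Fintype V] [DecidableEq V] (G : SimpleGraph V) [DecidableRel G.Adj] (β h : ℝ)

/-- The real part of the unnormalized Gibbs state, `A ↦ Re Tr (A exp(-β H))`. -/
def weight (A : Operator V) : ℝ := (A * boltzmann G β h).trace.re

theorem weight_add (A B : Operator V) :
    weight G β h (A + B) = weight G β h A + weight G β h B := by
  simp [weight, add_mul]

theorem weight_neg (A : Operator V) : weight G β h (-A) = -weight G β h A := by
  simp [weight]

theorem weight_smul (c : ℝ) (A : Operator V) :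
    weight G β h ((c : ℂ) • A) = c * weight G β h A := by
  simp [weight]

theorem weight_sum {ι : Type*} (s : Finset ι) (f : ι → Operator V) :
    weight G β h (∑ i ∈ s, f i) = ∑ i ∈ s, weight G β h (f i) := by
  simp [weight, Finset.sum_mul, Matrix.trace_sum]

theorem weight_mul_self_nonneg {A : Operator V} (hA : A.IsHermitian) :
    0 ≤ weight G β h (A * A) := by
  have h1 := ((posSemidef_boltzmann G β h).mul_mul_conjTranspose_same A).trace_nonneg
  rw [hA.eq, Matrix.trace_mul_cycle] at h1
  exact (Complex.le_def.1 h1).1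

theorem weight_one_pos : 0 < weight G β h 1 := by
  have h1 := posSemidef_boltzmann G β h
  rw [weight, one_mul]
  refine lt_of_le_of_ne (Complex.le_def.1 h1.trace_nonneg).1 fun h2 => ?_
  have h3 : (boltzmann G β h).trace = 0 :=
    Complex.ext h2.symm (Complex.le_def.1 h1.trace_nonneg).2.symm
  have h4 : IsUnit (boltzmann G β h) := Matrix.isUnit_exp _
  rw [h1.trace_eq_zero_iff.1 h3] at h4
  exact not_isUnit_zero h4

/-- The elementary form of `|⟨A B⟩| ≤ ‖A‖ ‖B‖` for commuting Hermitian `A` and `B` with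
`A² = B² = 1/4`. -/
theorem abs_weight_mul_le {A B : Operator V} (hA : A.IsHermitian) (hB : B.IsHermitian)
    (hAB : Commute A B) (hA2 : A * A = (1 / 4 : ℂ) • 1) (hB2 : B * B = (1 / 4 : ℂ) • 1) :
    |weight G β h (A * B)| ≤ weight G β h 1 / 4 := by
  have h1 := weight_mul_self_nonneg G β h (hA.add hB)
  have h2 := weight_mul_self_nonneg G β h (hA.sub hB)
  have h3 : (A + B) * (A + B) = ((1 / 2 : ℝ) : ℂ) • 1 + ((2 : ℝ) : ℂ) • (A * B) := by
    rw [add_mul, mul_add, mul_add, hA2, hB2, ← hAB.eq]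
    push_cast
    module
  have h4 : (A - B) * (A - B) = ((1 / 2 : ℝ) : ℂ) • 1 + ((-2 : ℝ) : ℂ) • (A * B) := by
    rw [sub_mul, mul_sub, mul_sub, hA2, hB2, ← hAB.eq]
    push_cast
    module
  rw [h3, weight_add, weight_smul, weight_smul] at h1
  rw [h4, weight_add, weight_smul, weight_smul] at h2
  exact abs_le.2 ⟨by linarith, by linarith⟩

theorem abs_weight_spinOp_mul_spinOp_le {x y : V} (hxy : x ≠ y) (i : Fin 3) :
    |weight G β h (spinOp i x * spinOp i y)| ≤ weight G β h 1 / 4 :=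
  abs_weight_mul_le G β h (conjTranspose_spinOp i x) (conjTranspose_spinOp i y)
    (commute_spinOp hxy i i) (spinOp_mul_self i x) (spinOp_mul_self i y)

theorem abs_weight_spinOp_le (i : Fin 3) (x : V) :
    |weight G β h (spinOp i x)| ≤ weight G β h 1 / 2 := by
  have h1 : (((1 / 2 : ℝ) : ℂ) • (1 : Operator V)).IsHermitian := by
    simp [Matrix.IsHermitian, Matrix.conjTranspose_smul]
  have h2 := abs_weight_mul_le G β h h1 (conjTranspose_spinOp i x)
    ((Commute.one_left _).smul_left _) (by
      rw [smul_mul_smul_comm, mul_one]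
      norm_num) (spinOp_mul_self i x)
  rw [smul_mul_assoc, one_mul, weight_smul, abs_mul, abs_of_pos (by norm_num)] at h2
  linarith

theorem weight_neg_lie_twist_lie_twist_le (φ : V → ℝ) :
    weight G β h (-⁅twist φ, ⁅twist φ, hamiltonian G h⁆⁆) ≤ weight G β h 1 *
      ((∑ x, ∑ y, if G.Adj x y then (φ x - φ y) ^ 2 else 0) / 4 + |h| / 2 * ∑ x, φ x ^ 2) := by
  set Z := weight G β h 1
  have h1 (x y : V) : weight G β h (if G.Adj x y then ((φ x - φ y : ℂ) ^ 2) •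
      (spinOp 1 x * spinOp 1 y + spinOp 2 x * spinOp 2 y) else 0)
        ≤ (if G.Adj x y then (φ x - φ y) ^ 2 else 0) * (Z / 2) := by
    split_ifs with hxy
    · have h2 : ((φ x - φ y : ℂ) ^ 2) = (((φ x - φ y) ^ 2 : ℝ) : ℂ) := by push_cast; rfl
      rw [h2, weight_smul, weight_add]
      refine mul_le_mul_of_nonneg_left ?_ (sq_nonneg _)
      have h3 := (abs_le.1 (abs_weight_spinOp_mul_spinOp_le G β h hxy.ne 1)).2
      have h4 := (abs_le.1 (abs_weight_spinOp_mul_spinOp_le G β h hxy.ne 2)).2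
      linarith
    · simp [weight]
  have h2 (x : V) : h * weight G β h (((φ x : ℂ) ^ 2) • spinOp 2 x) ≤ |h| * (φ x ^ 2 * (Z / 2)) := by
    refine (le_abs_self _).trans ?_
    rw [← Complex.ofReal_pow, weight_smul, abs_mul, abs_mul, abs_of_nonneg (sq_nonneg (φ x))]
    gcongr
    exact abs_weight_spinOp_le G β h 2 x
  have h3 : (1 / 2 : ℂ) = ((1 / 2 : ℝ) : ℂ) := by push_cast; rfl
  rw [neg_lie_twist_lie_twist_hamiltonian, weight_add, h3, weight_smul, weight_smul, weight_sum,
    weight_sum]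
  have h4 := Finset.sum_le_sum fun x (_ : x ∈ Finset.univ) =>
    Finset.sum_le_sum fun y (_ : y ∈ Finset.univ) => h1 x y
  have h5 := Finset.sum_le_sum fun x (_ : x ∈ Finset.univ) => h2 x
  simp only [← Finset.sum_mul, ← Finset.mul_sum] at h4 h5
  simp only [weight_sum]
  linarith

/-- The magnetization at a site is controlled by the energy of any profile `φ` which equals `1`
there: Bogoliubov's inequality with `C = ∑ₓ φₓ Sₓ⁽¹⁾` and `A = S⁽²⁾` at the site. -/
theorem sq_weight_spinOp_le {β : ℝ} (hβ : 0 ≤ β) {φ : V → ℝ} {o : V} (hφ : φ o = 1) :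
    (weight G β h (spinOp 2 o) / weight G β h 1) ^ 2 ≤ β / 2 *
      ((∑ x, ∑ y, if G.Adj x y then (φ x - φ y) ^ 2 else 0) / 4 + |h| / 2 * ∑ x, φ x ^ 2) := by
  have hZ := weight_one_pos G β h
  have h1 := bogoliubov (isHermitian_hamiltonian G h) (conjTranspose_spinOp 1 o)
    (isHermitian_twist φ) hβ
  have h2 : |weight G β h (spinOp 2 o)|
      ≤ ‖(⁅twist φ, spinOp 1 o⁆ * boltzmann G β h).trace‖ := by
    rw [lie_twist_spinOp_one, hφ, smul_mul_assoc, Matrix.trace_smul, norm_smul]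
    simpa [weight] using Complex.abs_re_le_norm (spinOp 2 o * boltzmann G β h).trace
  have h3 : (spinOp 1 o * spinOp 1 o * boltzmann G β h).trace.re = 1 / 4 * weight G β h 1 := by
    rw [spinOp_mul_self, ← weight_smul, weight]
    push_cast
    rfl
  have h4 : -(⁅twist φ, ⁅twist φ, hamiltonian G h⁆⁆ * boltzmann G β h).trace.re
      = weight G β h (-⁅twist φ, ⁅twist φ, hamiltonian G h⁆⁆) := (weight_neg G β h _).symm
  change ‖(_ * boltzmann G β h).trace‖ ^ 2 ≤ β * (2 * (_ * boltzmann G β h).trace.re) *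
    -(_ * boltzmann G β h).trace.re at h1
  rw [h3, h4] at h1
  have h5 := (pow_le_pow_left₀ (abs_nonneg _) h2 2).trans h1
  rw [div_pow, div_le_iff₀ (by positivity), ← sq_abs]
  refine h5.trans ?_
  have h6 := mul_le_mul_of_nonneg_left (weight_neg_lie_twist_lie_twist_le G β h φ)
    (show 0 ≤ β * (2 * (1 / 4 * weight G β h 1)) by positivity)
  refine h6.trans_eq ?_
  ring

theorem gibbs_magnetization_re :
    (gibbs G β h (magnetization V)).re
      = ∑ x, weight G β h (spinOp 2 x) / weight G β h 1 := by
  have h1 : partitionFunction G β h = (weight G β h 1 : ℂ) := by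
    have h2 := (Complex.le_def.1 (posSemidef_boltzmann G β h).trace_nonneg).2
    refine Complex.ext ?_ ?_
    · simp [weight, partitionFunction]
    · simpa [partitionFunction] using h2.symm
  rw [gibbs, h1, Complex.div_ofReal_re, ← Finset.sum_div, ← weight_sum]
  rfl

end Gibbs

/-! ### Geometry of the discrete torus -/

section Torus

variable {d n : ℕ}

/-- The sup-norm distance of `x` from the origin in the torus `(ℤ/nℤ)ᵈ`. -/
def torusNorm (x : Fin d → ZMod n) : ℕ :=
  Finset.univ.sup fun i => (x i).valMinAbs.natAbs

theorem torusNorm_zero : torusNorm (0 : Fin d → ZMod n) = 0 := by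
  simp [torusNorm]

theorem natAbs_valMinAbs_le_torusNorm (x : Fin d → ZMod n) (i : Fin d) :
    (x i).valMinAbs.natAbs ≤ torusNorm x :=
  Finset.le_sup (f := fun i => (x i).valMinAbs.natAbs) (Finset.mem_univ i)

theorem torusNorm_neg (x : Fin d → ZMod n) : torusNorm (-x) = torusNorm x := by
  simp only [torusNorm, Pi.neg_apply, ZMod.natAbs_valMinAbs_neg]

theorem torusNorm_add_le (x y : Fin d → ZMod n) :
    torusNorm (x + y) ≤ torusNorm x + torusNorm y := by
  refine Finset.sup_le fun i _ => ?_
  rw [Pi.add_apply]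
  refine (ZMod.natAbs_valMinAbs_add_le _ _).trans ((Int.natAbs_add_le _ _).trans ?_)
  exact add_le_add (natAbs_valMinAbs_le_torusNorm x i) (natAbs_valMinAbs_le_torusNorm y i)

theorem torusNorm_single_one_le (i : Fin d) :
    torusNorm (Pi.single i 1 : Fin d → ZMod n) ≤ 1 := by
  have h1 : (1 : ZMod n).valMinAbs.natAbs ≤ 1 := by
    rcases n with _ | n
    · exact le_refl 1
    · simpa using ZMod.natAbs_min_of_le_div_two (n + 1) (1 : ZMod (n + 1)).valMinAbs 1 (by simp)
        (ZMod.natAbs_valMinAbs_le _)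
  refine Finset.sup_le fun j _ => ?_
  by_cases hj : j = i
  · rwa [hj, Pi.single_eq_same]
  · simp [Pi.single_eq_of_ne hj]

theorem torusNorm_le_of_adj {x y : Fin d → ZMod n} (hxy : (periodicBox d n).Adj x y)
    (o : Fin d → ZMod n) : torusNorm (x - o) ≤ torusNorm (y - o) + 1 := by
  obtain ⟨-, i, h | h⟩ := hxy
  · have h1 : x - o = (y - o) + -Pi.single i 1 := by rw [h]; abel
    rw [h1]
    refine (torusNorm_add_le _ _).trans (Nat.add_le_add_left ?_ _)
    rw [torusNorm_neg]
    exact torusNorm_single_one_le i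
  · have h1 : x - o = (y - o) + Pi.single i 1 := by rw [h]; abel
    rw [h1]
    exact (torusNorm_add_le _ _).trans (Nat.add_le_add_left (torusNorm_single_one_le i) _)

variable [NeZero n]

theorem card_adj_le (x : Fin d → ZMod n) :
    (Finset.univ.filter fun y => (periodicBox d n).Adj x y).card ≤ 2 * d := by
  have h1 : (Finset.univ.filter fun y => (periodicBox d n).Adj x y) ⊆
      (Finset.univ.image fun i : Fin d => x + Pi.single i 1) ∪
        Finset.univ.image fun i : Fin d => x - Pi.single i 1 := by
    intro y hy
    obtain ⟨-, i, h | h⟩ := (Finset.mem_filter.1 hy).2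
    · exact Finset.mem_union_left _ (Finset.mem_image.2 ⟨i, Finset.mem_univ _, h.symm⟩)
    · exact Finset.mem_union_right _ (Finset.mem_image.2 ⟨i, Finset.mem_univ _, by rw [h]; abel⟩)
  have h2 : ∀ f : Fin d → Fin d → ZMod n, (Finset.univ.image f).card ≤ d := fun f =>
    Finset.card_image_le.trans_eq (Finset.card_fin d)
  refine (Finset.card_le_card h1).trans ((Finset.card_union_le _ _).trans ?_)
  have := add_le_add (h2 fun i => x + Pi.single i 1) (h2 fun i => x - Pi.single i 1)
  omega

/-- In dimension at most two the spheres of the torus grow at most linearly. -/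
theorem card_torusNorm_eq_le (hd : d = 1 ∨ d = 2) (o : Fin d → ZMod n) (r : ℕ) :
    (Finset.univ.filter fun x => torusNorm (x - o) = r).card ≤ 8 * (r + 1) := by
  have h1 : (Finset.univ.filter fun x => torusNorm (x - o) = r).card
      = (Finset.univ.filter fun x : Fin d → ZMod n => torusNorm x = r).card :=
    Finset.card_equiv (Equiv.subRight o) (by simp)
  have hinj : Function.Injective (ZMod.valMinAbs : ZMod n → ℤ) := ZMod.injective_valMinAbs
  rw [h1]
  -- the sphere of radius `r` consists of integer vectors with entries in `[-r, r]`, one of which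
  -- is `r` or `-r`
  set I : Finset ℤ := Finset.Icc (-(r : ℤ)) r
  set E : Finset ℤ := {(r : ℤ), -(r : ℤ)}
  have hI : I.card = 2 * r + 1 := by
    rw [Int.card_Icc]
    omega
  have hE : E.card ≤ 2 := Finset.card_le_two
  have hmemI {a : ℤ} (ha : a.natAbs ≤ r) : a ∈ I := Finset.mem_Icc.2 (by omega)
  have hmemE {a : ℤ} (ha : a.natAbs = r) : a ∈ E := by
    simp only [E, Finset.mem_insert, Finset.mem_singleton]
    omega
  rcases hd with rfl | rfl
  · have h2 : (Finset.univ.filter fun x : Fin 1 → ZMod n => torusNorm x = r).card ≤ E.card := by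
      refine Finset.card_le_card_of_injOn (fun x => (x 0).valMinAbs) (fun x hx => hmemE ?_)
        fun x _ y _ hxy => ?_
      · simpa [torusNorm] using hx
      · exact funext fun i => by rw [Subsingleton.elim i 0]; exact hinj hxy
    omega
  · have h2 : (Finset.univ.filter fun x : Fin 2 → ZMod n => torusNorm x = r).card
        ≤ ((E ×ˢ I) ∪ (I ×ˢ E)).card := by
      refine Finset.card_le_card_of_injOn (fun x => ((x 0).valMinAbs, (x 1).valMinAbs))
        (fun x hx => ?_) fun x _ y _ hxy => ?_
      · have hx' : torusNorm x = r := by simpa using hx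
        have h3 := natAbs_valMinAbs_le_torusNorm x 0
        have h4 := natAbs_valMinAbs_le_torusNorm x 1
        have h5 : max (x 0).valMinAbs.natAbs (x 1).valMinAbs.natAbs = r := by
          simpa [torusNorm, Fin.univ_succ] using hx'
        rw [Finset.mem_coe, Finset.mem_union, Finset.mem_product, Finset.mem_product]
        rcases max_choice (x 0).valMinAbs.natAbs (x 1).valMinAbs.natAbs with h6 | h6
        · exact Or.inl ⟨hmemE (h6.symm.trans h5), hmemI (h4.trans hx'.le)⟩
        · exact Or.inr ⟨hmemI (h3.trans hx'.le), hmemE (h6.symm.trans h5)⟩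
      · obtain ⟨h3, h4⟩ := Prod.mk.inj hxy
        exact funext (Fin.forall_fin_two.2 ⟨hinj h3, hinj h4⟩)
    have h3 := Finset.card_union_le (E ×ˢ I) (I ×ˢ E)
    rw [Finset.card_product, Finset.card_product, hI] at h3
    have h4 : E.card * (2 * r + 1) ≤ 2 * (2 * r + 1) := Nat.mul_le_mul_right _ hE
    have h5 : (2 * r + 1) * E.card ≤ (2 * r + 1) * 2 := Nat.mul_le_mul_left _ hE
    omega

theorem sum_torusNorm_le (hd : d = 1 ∨ d = 2) (o : Fin d → ZMod n) {F : ℕ → ℝ} {R : ℕ}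
    (hF : ∀ r, 0 ≤ F r) (hFR : ∀ r, R ≤ r → F r = 0) :
    ∑ x : Fin d → ZMod n, F (torusNorm (x - o)) ≤ ∑ r ∈ Finset.range R, 8 * (r + 1 : ℝ) * F r := by
  have h1 (x : Fin d → ZMod n) : F (torusNorm (x - o))
      = ∑ r ∈ Finset.range R, if torusNorm (x - o) = r then F r else 0 := by
    rw [Finset.sum_ite_eq]
    split_ifs with h
    · rfl
    · exact hFR _ (by simpa using h)
  simp only [h1]
  rw [Finset.sum_comm]
  refine Finset.sum_le_sum fun r _ => ?_
  rw [← Finset.sum_filter, Finset.sum_const, nsmul_eq_mul]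
  refine mul_le_mul_of_nonneg_right ?_ (hF r)
  exact_mod_cast card_torusNorm_eq_le hd o r

end Torus

/-! ### The logarithmic profile -/

/-- The real-valued harmonic sum `∑_{j < R} 1 / (j + 1)`. -/
def harmonicSum (R : ℕ) : ℝ := ∑ j ∈ Finset.range R, 1 / (j + 1 : ℝ)

/-- The logarithmically decaying radial profile: `1` at `0`, vanishing from `R` on, and with
increments proportional to `1 / (r + 1)` in between. -/
def logProfile (R r : ℕ) : ℝ := (∑ j ∈ Finset.Ico r R, 1 / (j + 1 : ℝ)) / harmonicSum R

theorem harmonicSum_pos {R : ℕ} (hR : 0 < R) : 0 < harmonicSum R :=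
  Finset.sum_pos (fun j _ => by positivity) (Finset.nonempty_range_iff.2 hR.ne')

theorem harmonicSum_nonneg (R : ℕ) : 0 ≤ harmonicSum R :=
  Finset.sum_nonneg fun j _ => by positivity

theorem logProfile_zero {R : ℕ} (hR : 0 < R) : logProfile R 0 = 1 := by
  rw [logProfile, ← Finset.range_eq_Ico]
  exact div_self (harmonicSum_pos hR).ne'

theorem logProfile_of_le {R r : ℕ} (h : R ≤ r) : logProfile R r = 0 := by
  rw [logProfile, Finset.Ico_eq_empty_of_le h, Finset.sum_empty, zero_div]

theorem logProfile_nonneg (R r : ℕ) : 0 ≤ logProfile R r :=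
  div_nonneg (Finset.sum_nonneg fun j _ => by positivity) (harmonicSum_nonneg R)

theorem logProfile_le_one (R r : ℕ) : logProfile R r ≤ 1 := by
  refine div_le_one_of_le₀ ?_ (harmonicSum_nonneg R)
  rw [harmonicSum, Finset.range_eq_Ico]
  exact Finset.sum_le_sum_of_subset_of_nonneg (Finset.Ico_subset_Ico_left (Nat.zero_le r))
    fun j _ _ => by positivity

theorem logProfile_sub_succ {R r : ℕ} (h : r < R) :
    logProfile R r - logProfile R (r + 1) = 1 / (r + 1 : ℝ) / harmonicSum R := by
  rw [logProfile, logProfile, ← sub_div, Finset.sum_eq_sum_Ico_succ_bot h, add_sub_cancel_right]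

/-- The squared increment of the logarithmic profile from `r` to `r + 1`. -/
def sqIncrement (R r : ℕ) : ℝ := (logProfile R r - logProfile R (r + 1)) ^ 2

theorem sqIncrement_of_le {R r : ℕ} (h : R ≤ r) : sqIncrement R r = 0 := by
  rw [sqIncrement, logProfile_of_le h, logProfile_of_le (h.trans (Nat.le_succ r))]
  simp

theorem sq_logProfile_sub_le {R r s : ℕ} (hrs : r ≤ s + 1) (hsr : s ≤ r + 1) :
    (logProfile R r - logProfile R s) ^ 2 ≤ sqIncrement R r + sqIncrement R s := by
  have h1 : 0 ≤ sqIncrement R r := sq_nonneg _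
  have h2 : 0 ≤ sqIncrement R s := sq_nonneg _
  obtain rfl | rfl | rfl : s = r ∨ s = r + 1 ∨ r = s + 1 := by omega
  · rw [sub_self]
    linarith
  · exact le_add_of_nonneg_right h2
  · rw [← neg_sq, neg_sub]
    exact le_add_of_nonneg_left h1

theorem sum_sqIncrement (R : ℕ) :
    ∑ r ∈ Finset.range R, 8 * (r + 1 : ℝ) * sqIncrement R r = 8 / harmonicSum R := by
  have h1 : ∀ r ∈ Finset.range R, 8 * (r + 1 : ℝ) * sqIncrement R r
      = 8 / harmonicSum R ^ 2 * (1 / (r + 1 : ℝ)) := fun r hr => by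
    have h2 : (r + 1 : ℝ) ≠ 0 := by positivity
    rw [sqIncrement, logProfile_sub_succ (Finset.mem_range.1 hr)]
    field_simp
  rw [Finset.sum_congr rfl h1, ← Finset.mul_sum]
  change 8 / harmonicSum R ^ 2 * harmonicSum R = 8 / harmonicSum R
  rcases eq_or_ne (harmonicSum R) 0 with h0 | h0
  · simp [h0]
  · field_simp

section Profile

variable {d n : ℕ} [NeZero n]

/-- The gradient energy of the logarithmic profile is at most of order `1 / log R`, uniformly in
the size of the torus. -/
theorem energy_logProfile_le (hd : d = 1 ∨ d = 2) (o : Fin d → ZMod n) (R : ℕ) :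
    (∑ x, ∑ y, if (periodicBox d n).Adj x y then
      (logProfile R (torusNorm (x - o)) - logProfile R (torusNorm (y - o))) ^ 2 else 0)
        ≤ 64 / harmonicSum R := by
  set g : (Fin d → ZMod n) → ℝ := fun x => sqIncrement R (torusNorm (x - o))
  have hg (x) : 0 ≤ g x := sq_nonneg _
  have h1 : (∑ x, ∑ y, if (periodicBox d n).Adj x y then
      (logProfile R (torusNorm (x - o)) - logProfile R (torusNorm (y - o))) ^ 2 else 0)
      ≤ ∑ x, ∑ y, ((if (periodicBox d n).Adj x y then g x else 0)
        + if (periodicBox d n).Adj y x then g y else 0) := by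
    refine Finset.sum_le_sum fun x _ => Finset.sum_le_sum fun y _ => ?_
    by_cases hxy : (periodicBox d n).Adj x y
    · rw [if_pos hxy, if_pos hxy, if_pos hxy.symm]
      exact sq_logProfile_sub_le (torusNorm_le_of_adj hxy o) (torusNorm_le_of_adj hxy.symm o)
    · rw [if_neg hxy, if_neg hxy, if_neg fun h => hxy h.symm, add_zero]
  have h2 : ∑ x, ∑ y, (if (periodicBox d n).Adj x y then g x else 0) ≤ 4 * ∑ x, g x := by
    rw [Finset.mul_sum]
    refine Finset.sum_le_sum fun x _ => ?_
    rw [← Finset.sum_filter, Finset.sum_const, nsmul_eq_mul]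
    refine mul_le_mul_of_nonneg_right ?_ (hg x)
    have h3 : (Finset.univ.filter fun y => (periodicBox d n).Adj x y).card ≤ 4 :=
      (card_adj_le x).trans (by omega)
    exact_mod_cast h3
  have h3 : ∑ x, ∑ y, (if (periodicBox d n).Adj y x then g y else 0) ≤ 4 * ∑ x, g x := by
    rwa [Finset.sum_comm]
  have h4 : ∑ x, g x ≤ 8 / harmonicSum R :=
    (sum_torusNorm_le hd o (F := sqIncrement R) (fun r => sq_nonneg _)
      fun r hr => sqIncrement_of_le hr).trans_eq (sum_sqIncrement R)
  simp only [Finset.sum_add_distrib] at h1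
  have h5 : 64 / harmonicSum R = 8 * (8 / harmonicSum R) := by ring
  linarith

theorem sum_sq_logProfile_le (hd : d = 1 ∨ d = 2) (o : Fin d → ZMod n) (R : ℕ) :
    ∑ x, logProfile R (torusNorm (x - o)) ^ 2 ≤ 8 * (R : ℝ) ^ 2 := by
  refine (sum_torusNorm_le hd o (F := fun r => logProfile R r ^ 2) (R := R)
    (fun r => sq_nonneg _) fun r hr => by simp [logProfile_of_le hr]).trans ?_
  have h1 : ∀ r ∈ Finset.range R, 8 * (r + 1 : ℝ) * logProfile R r ^ 2 ≤ 8 * R := fun r hr => by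
    have h2 : (r + 1 : ℝ) ≤ R := by exact_mod_cast Finset.mem_range.1 hr
    have h3 : logProfile R r ^ 2 ≤ 1 := pow_le_one₀ (logProfile_nonneg R r) (logProfile_le_one R r)
    calc 8 * (r + 1 : ℝ) * logProfile R r ^ 2 ≤ 8 * (r + 1 : ℝ) * 1 := by gcongr
      _ ≤ 8 * R := by linarith
  refine (Finset.sum_le_card_nsmul _ _ _ h1).trans_eq ?_
  rw [Finset.card_range, nsmul_eq_mul]
  ring

/-! ### Absence of residual magnetization -/

/-- The bound on the magnetization density given by the logarithmic profile of radius `R`; it does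
not depend on the size `n` of the torus. -/
theorem sq_magnetizationDensity_le (hd : d = 1 ∨ d = 2) {β : ℝ} (hβ : 0 ≤ β) (h : ℝ) {R : ℕ}
    (hR : 0 < R) :
    magnetizationDensity d n β h ^ 2 ≤ β * (8 / harmonicSum R + 2 * |h| * R ^ 2) := by
  set B := β * (8 / harmonicSum R + 2 * |h| * R ^ 2)
  set G := periodicBox d n
  have hsite (o : Fin d → ZMod n) :
      |weight G β h (spinOp 2 o) / weight G β h 1| ≤ √B := by
    refine Real.abs_le_sqrt ((sq_weight_spinOp_le G h hβ
      (φ := fun x => logProfile R (torusNorm (x - o))) (o := o) ?_).trans ?_)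
    · rw [sub_self, torusNorm_zero, logProfile_zero hR]
    · have h1 := energy_logProfile_le hd o R
      have h2 := mul_le_mul_of_nonneg_left (sum_sq_logProfile_le hd o R) (abs_nonneg h)
      have h3 : B = β / 2 * (64 / harmonicSum R / 4 + |h| * (8 * R ^ 2) / 2) := by
        simp only [B]
        ring
      rw [h3]
      refine mul_le_mul_of_nonneg_left ?_ (by positivity)
      linarith
  have hB : 0 ≤ B := mul_nonneg hβ (add_nonneg (div_nonneg (by norm_num) (harmonicSum_nonneg R))
    (by positivity))
  have hn : (0 : ℝ) < (n : ℝ) ^ d := pow_pos (Nat.cast_pos.2 (NeZero.pos n)) d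
  rw [← Real.sqrt_le_sqrt_iff hB, Real.sqrt_sq_eq_abs, magnetizationDensity, abs_div,
    abs_of_pos hn, div_le_iff₀ hn, gibbs_magnetization_re]
  refine (Finset.abs_sum_le_sum_abs _ _).trans ((Finset.sum_le_sum fun o _ => hsite o).trans_eq ?_)
  simp [ZMod.card, mul_comm]

end Profile

theorem sq_limitMagnetization_le {d : ℕ} (hd : d = 1 ∨ d = 2) {β : ℝ} (hβ : 0 ≤ β) (h : ℝ)
    {R : ℕ} (hR : 0 < R) :
    limitMagnetization d β h ^ 2 ≤ β * (8 / harmonicSum R + 2 * |h| * R ^ 2) := by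
  set B := β * (8 / harmonicSum R + 2 * |h| * R ^ 2)
  have hB : 0 ≤ B := mul_nonneg hβ (add_nonneg (div_nonneg (by norm_num) (harmonicSum_nonneg R))
    (by positivity))
  have h1 (n : ℕ) := abs_le.1
    (Real.abs_le_sqrt (sq_magnetizationDensity_le (n := n + 1) hd hβ h hR))
  have hbdd : IsBoundedUnder (· ≥ ·) atTop fun n : ℕ => magnetizationDensity d (n + 1) β h :=
    isBoundedUnder_of ⟨_, fun n => (h1 n).1⟩
  have hcobdd : IsCoboundedUnder (· ≥ ·) atTop fun n : ℕ => magnetizationDensity d (n + 1) β h :=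
    (isBoundedUnder_of ⟨_, fun n => (h1 n).2⟩ :
      IsBoundedUnder (· ≤ ·) atTop _).isCoboundedUnder_ge
  have h2 : |limitMagnetization d β h| ≤ √B :=
    abs_le.2 ⟨le_liminf_of_le hcobdd (Eventually.of_forall fun n => (h1 n).1),
      liminf_le_of_le hbdd fun b hb =>
        let ⟨n, hn⟩ := hb.exists
        hn.trans (h1 n).2⟩
  rw [← sq_abs, ← Real.sq_sqrt hB]
  exact pow_le_pow_left₀ (abs_nonneg _) h2 2

end Heisenberg

end

theorem mainTheorem6 (d : ℕ) (hd : d = 1 ∨ d = 2) (β : ℝ) (hβ : 0 ≤ β) :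
    Heisenberg.HasResidualMagnetization d β 0 := by
  rw [Heisenberg.HasResidualMagnetization, Metric.tendsto_nhds]
  intro ε hε
  have hlim : Tendsto (fun R => β * (8 / Heisenberg.harmonicSum R)) atTop (𝓝 (β * 0)) :=
    (Real.tendsto_sum_range_one_div_nat_succ_atTop.const_div_atTop 8).const_mul β
  rw [mul_zero] at hlim
  -- the radius `R` is fixed first, and then `h` is sent to zero
  obtain ⟨R, hRε, hR⟩ :=
    ((hlim.eventually_lt_const (pow_pos hε 2)).and (eventually_gt_atTop 0)).exists
  have hcont : Tendsto (fun h : ℝ => β * (8 / Heisenberg.harmonicSum R + 2 * |h| * R ^ 2))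
      (𝓝[>] 0) (𝓝 (β * (8 / Heisenberg.harmonicSum R + 2 * |(0 : ℝ)| * R ^ 2))) :=
    (Continuous.tendsto (by fun_prop) 0).mono_left nhdsWithin_le_nhds
  rw [abs_zero, mul_zero, zero_mul, add_zero] at hcont
  filter_upwards [hcont.eventually_lt_const hRε] with h hh
  rw [Real.dist_0_eq_abs]
  exact abs_lt_of_sq_lt_sq ((Heisenberg.sq_limitMagnetization_le hd hβ h hR).trans_lt hh) hε.le
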